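/- **Lemma 5 (Asymptotic MMSE of position-modulated signals).** Let $L_n,B_n\to\infty$ be sequences of natural numbers, put $N_n=L_nB_n$, and for every $n$ let $p_{n,1}\ge p_{n,2}\ge\dots\ge p_{n,L_n}$ be powers with $\sum_{l=1}^{L_n}p_{n,l}/N_n=1$ and $cB_n\le p_{n,l}\le CB_n$ for all $n,l$, where $0<c\le C$ are constants independent of $n,l$. Let $\mathbf s_n\in\mathbb C^{N_n}$ be the position-modulated signal that consists of $L_n$ independent sections of dimension $B_n$, the $l$-th of which has a single nonzero entry $\sqrt{p_{n,l}}$ at a uniformly distributed position, and let $\mathbf z\sim\mathcal{CN}(\mathbf 0,\mathbf I)$ be independent of $\mathbf s_n$. For $\varrho\ge0$ let $$\hat\phi_n(\varrho)=\frac1{N_n}\,\mathbb E\Big[\big\|\mathbf s_n-\mathbb E[\mathbf s_n\mid\sqrt\varrho\,\mathbf s_n+\mathbf z]\big\|^2\Big],\qquad \hat\phi_{\rm Gau}(\varrho)=\frac1{1+\varrho},\qquad P_{n,l}=\sum_{k=l}^{L_n}\frac{p_{n,k}}{N_n},$$ $$\hat\psi_n(\varrho)=\sum_{l=1}^{L_n}P_{n,l}\,\hat\phi_{\rm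 Gau}(\varrho P_{n,l})\cdot\mathbb I\Big(\frac{\log B_n}{p_{n,l-1}}\le\varrho<\frac{\log B_n}{p_{n,l}}\Big),\qquad \frac{\log B_n}{p_{n,0}}:=0 .$$ Let further, for $\delta>0$, $$T_{n,\delta}(\varrho)=\frac1{N_n}\sum_{l\,:\,|\varrho p_{n,l}-\log B_n|\le\delta\log B_n}p_{n,l}$$ denote the share of the total power in the sections whose phase transition point $\log B_n/p_{n,l}$ is at $\varrho$ up to relative accuracy $\delta$. Then $\hat\phi_n\simeq\hat\psi_n$ away from the phase transition points, in the following sense. 1. For all $\varepsilon,\delta>0$ there is an $n_0$ such that for all $n\ge n_0$ and all $\varrho\ge0$, $$\big|\hat\phi_n(\varrho)-\hat\psi_n(\varrho)\big|\le\varepsilon+T_{n,\delta}(\varrho).$$ 2. $\hat\phi_n(\varrho_n)-\hat\psi_n(\varrho_n)\to0$ for every sequence $\varrho_n\ge0$ at which no non-vanishing share of the power is in transition, that is, for which every $\eta>0$ admits a $\delta>0$ with $T_{n,\delta}(\varrho_n)\le\eta$ for all sufficiently large $n$. (In particular, for every fixed $\varrho\ge 0$.) -/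

import Mathlib

open MeasureTheory ProbabilityTheory Filter Topology

noncomputable section

namespace PositionModulated

/-- The standard circularly symmetric complex Gaussian law `CN(0,1)`: real and imaginary parts are
independent real Gaussians with mean `0` and variance `1/2`. -/
def stdComplexGaussian : Measure ℂ :=
  ((gaussianReal 0 (1 / 2)).prod (gaussianReal 0 (1 / 2))).map
    Complex.measurableEquivRealProd.symm

/-- The law of the positions of the nonzero entries of `L` sections of dimension `B`:
independent over the sections, uniform on each. -/
def positionLaw (L B : ℕ) : Measure (Fin L → Fin B) :=
  Measure.pi fun _ => uniformOn (Set.univ : Set (Fin B))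

/-- The law `CN(0, I)` of the noise, with one coordinate for every entry of the signal. -/
def noiseLaw (L B : ℕ) : Measure (Fin L × Fin B → ℂ) :=
  Measure.pi fun _ => stdComplexGaussian

/-- The joint law of the positions and of the noise, which are independent. -/
def jointLaw (L B : ℕ) : Measure ((Fin L → Fin B) × (Fin L × Fin B → ℂ)) :=
  (positionLaw L B).prod (noiseLaw L B)

/-- The position-modulated signal with section powers `p`: in section `l` the entry at the position
`pos l` is `√(p l)`, all other entries vanish. -/
def signal {L : ℕ} (B : ℕ) (p : Fin L → ℝ) (pos : Fin L → Fin B) :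
    EuclideanSpace ℂ (Fin L × Fin B) :=
  WithLp.toLp 2 fun i => if pos i.1 = i.2 then ((Real.sqrt (p i.1) : ℝ) : ℂ) else 0

/-- `E ‖s - E[s | √ϱ s + z]‖²` for a random vector `s` and a noise vector `z`. -/
def totalMMSE {Ω : Type*} [MeasurableSpace Ω] (μ : Measure Ω) {ι : Type*} [Fintype ι]
    (s z : Ω → EuclideanSpace ℂ ι) (ϱ : ℝ) : ℝ :=
  ∫ ω, ‖s ω - (μ[s | MeasurableSpace.comap (fun ω' => ((Real.sqrt ϱ : ℝ) : ℂ) • s ω' + z ω')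
    inferInstance]) ω‖ ^ 2 ∂μ

/-- The MMSE function of the position-modulated signal, normalised by its dimension `N = L B`. -/
def mmse {L : ℕ} (B : ℕ) (p : Fin L → ℝ) (ϱ : ℝ) : ℝ :=
  1 / ((L : ℝ) * B) *
    totalMMSE (jointLaw L B) (fun ω => signal B p ω.1) (fun ω => WithLp.toLp 2 ω.2) ϱ

/-- The MMSE function of a standard Gaussian signal. -/
def gaussMMSE (ϱ : ℝ) : ℝ := (1 + ϱ)⁻¹

/-- The residual power of the sections `l, l + 1, …`. -/
def residualPower {L : ℕ} (B : ℕ) (p : Fin L → ℝ) (l : Fin L) : ℝ :=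
  ∑ k ∈ Finset.Ici l, p k / ((L : ℝ) * B)

/-- The transition points: `0`, followed by `log B / p l` for the `L` sections in their order. Thus
section `l` has the interval from `transitionPoint B p l.castSucc` to
`transitionPoint B p l.succ`. -/
def transitionPoint {L : ℕ} (B : ℕ) (p : Fin L → ℝ) : Fin (L + 1) → ℝ :=
  Fin.cons 0 fun l => Real.log B / p l

open Classical in
/-- The piecewise function that describes the MMSE between the transition points. -/
def piecewiseMMSE {L : ℕ} (B : ℕ) (p : Fin L → ℝ) (ϱ : ℝ) : ℝ :=
  ∑ l : Fin L, residualPower B p l * gaussMMSE (ϱ * residualPower B p l) *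
    (if transitionPoint B p l.castSucc ≤ ϱ ∧ ϱ < transitionPoint B p l.succ then 1 else 0)

open Classical in
/-- The share of the total power that belongs to the sections whose transition takes place at `ϱ`
up to the relative accuracy `δ`, that is, with `|ϱ p l / log B - 1| ≤ δ`. -/
def transitionShare {L : ℕ} (B : ℕ) (p : Fin L → ℝ) (δ ϱ : ℝ) : ℝ :=
  ∑ l : Fin L, if |ϱ * p l - Real.log B| ≤ δ * Real.log B then p l / ((L : ℝ) * B) else 0

/-- The scaling regime for a sequence of codes with `L n` sections of dimension `B n` and section
powers `p n`: the numbers and dimensions of sections tend to infinity, the powers are nonincreasing,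
have average power one per entry, and are of the exact order `B n`, uniformly in the section. -/
structure IsScaling (L B : ℕ → ℕ) (p : (n : ℕ) → Fin (L n) → ℝ) : Prop where
  tendsto_sections : Tendsto L atTop atTop
  tendsto_dimension : Tendsto B atTop atTop
  antitone_power : ∀ n, Antitone (p n)
  power_constraint : ∀ n, ∑ l, p n l / ((L n : ℝ) * B n) = 1
  power_order : ∃ c C : ℝ, 0 < c ∧ ∀ n l, c * B n ≤ p n l ∧ p n l ≤ C * B n

end PositionModulated

end

noncomputable section

namespace PositionModulated

open scoped ENNReal

/-! Write `T = log B`. In a section of power `q` the nonzero entry appears with amplitude `a = √(ϱ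
q)`, while the largest real part among `B` noise entries is about `√T`. So the position is found if
`a ^ 2` exceeds `T` by a constant factor, and is hidden if it falls short by one. Hence the MMSE is
close to `Q`, the power share of the sections with `ϱ p l < T`, up to the sections near their
transition.

Upper bound: thresholding the real parts at `k a` with `k` slightly below `1` fails only through a
miss or one of at most `B` false alarms (`integral_sectionError_threshold_le`).

Lower bound: the relative gains of an estimate over the possible positions, cut off at `0`, add up
to at most `1`, so an estimate is no better than a randomised decision
(`sum_max_one_sub_sectionError_le`). A change of measure removes the section from the observation at
the price of a factor `exp (2 a t + a ^ 2)` and an exceptional probability `exp (-t ^ 2)`; without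
the section a decision is correct with probability at most `1 / B` (`lintegral_decision_le`).

Finally, since the powers are ordered, the piecewise function equals `Q / (1 + ϱ Q)`. If `Q ≠ 0`
then `ϱ ≤ T / (c B)`, which tends to `0`, so the Gaussian factor tends to `1` and the piecewise
function is close to `Q` as well (`abs_piecewiseMMSE_sub_powerShare_le`). -/

theorem lintegral_pi_update {ι : Type*} [Fintype ι] [DecidableEq ι] {X : ι → Type*}
    [∀ i, MeasurableSpace (X i)] (μ : ∀ i, Measure (X i)) [∀ i, IsProbabilityMeasure (μ i)]
    (i : ι) {F : (∀ i, X i) → ℝ≥0∞} (hF : Measurable F) :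
    ∫⁻ x, F x ∂Measure.pi μ
      = ∫⁻ x, ∫⁻ t, F (Function.update x i t) ∂μ i ∂Measure.pi μ := by
  have hm : Measurable fun x : ∀ i, X i => ∫⁻ t, F (Function.update x i t) ∂μ i := by
    have := hF.lmarginal (s := {i}) μ
    rw [lmarginal_singleton] at this
    exact this
  refine lintegral_eq_of_lmarginal_eq {i} hF hm ?_
  rw [lmarginal_singleton, lmarginal_singleton]
  funext x
  simp

theorem lintegral_uniformOn_univ {B : ℕ} (f : Fin B → ℝ≥0∞) :
    ∫⁻ j, f j ∂uniformOn (Set.univ : Set (Fin B)) = (∑ j, f j) / B := by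
  rw [uniformOn, ProbabilityTheory.cond, lintegral_smul_measure, Measure.restrict_univ, lintegral_count,
    tsum_fintype]
  simp [ENNReal.div_eq_inv_mul]

/-! ### Shifts and tails of the Gaussian law -/

theorem gaussianPDF_half (x : ℝ) :
    gaussianPDF 0 (1 / 2) x = ENNReal.ofReal ((√Real.pi)⁻¹ * Real.exp (-x ^ 2)) := by
  rw [gaussianPDF, gaussianPDFReal]
  congr 2
  · congr 2; push_cast; ring
  · congr 1; push_cast; ring

/-- The density ratio between `x` and `x + a` is `exp (2 a x + a ^ 2)`, which is bounded once `x ≤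
t`; the rest is translation invariance of Lebesgue measure. -/
theorem lintegral_gaussianReal_shift_le {h : ℝ → ℝ≥0∞} (hh : Measurable h) {a : ℝ} (ha : 0 ≤ a)
    (t : ℝ) :
    ∫⁻ x, h (x + a) * (Set.Iic t).indicator 1 x ∂gaussianReal 0 (1 / 2)
      ≤ ENNReal.ofReal (Real.exp (2 * a * t + a ^ 2)) * ∫⁻ x, h x ∂gaussianReal 0 (1 / 2) := by
  have hv : (1 / 2 : NNReal) ≠ 0 := by norm_num
  have hm : Measurable fun x => h (x + a) * (Set.Iic t).indicator 1 x :=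
    (hh.comp (measurable_id.add_const a)).mul (measurable_one.indicator measurableSet_Iic)
  rw [gaussianReal_of_var_ne_zero 0 hv,
    lintegral_withDensity_eq_lintegral_mul _ (measurable_gaussianPDF _ _) hm,
    lintegral_withDensity_eq_lintegral_mul _ (measurable_gaussianPDF _ _) hh,
    ← lintegral_const_mul _ ((measurable_gaussianPDF _ _).mul hh),
    ← lintegral_add_right_eq_self (fun x => ENNReal.ofReal (Real.exp (2 * a * t + a ^ 2)) *
      (gaussianPDF 0 (1 / 2) * h) x) a]
  refine lintegral_mono fun x => ?_
  simp only [Pi.mul_apply]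
  by_cases hx : x ≤ t
  · have : gaussianPDF 0 (1 / 2) x
        ≤ ENNReal.ofReal (Real.exp (2 * a * t + a ^ 2)) * gaussianPDF 0 (1 / 2) (x + a) := by
      rw [gaussianPDF_half, gaussianPDF_half, ← ENNReal.ofReal_mul (Real.exp_pos _).le]
      refine ENNReal.ofReal_le_ofReal ?_
      rw [mul_left_comm, ← Real.exp_add]
      gcongr
      nlinarith [mul_le_mul_of_nonneg_left hx ha]
    rw [Set.indicator_of_mem (by simpa using hx), Pi.one_apply, mul_one, ← mul_assoc]
    gcongr
  · rw [Set.indicator_of_notMem (by simpa using hx)]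
    simp

instance : IsProbabilityMeasure stdComplexGaussian :=
  Measure.isProbabilityMeasure_map Complex.measurableEquivRealProd.symm.measurable.aemeasurable

theorem lintegral_stdComplexGaussian {h : ℂ → ℝ≥0∞} (hh : Measurable h) :
    ∫⁻ z, h z ∂stdComplexGaussian
      = ∫⁻ y, ∫⁻ x, h ⟨x, y⟩ ∂gaussianReal 0 (1 / 2) ∂gaussianReal 0 (1 / 2) := by
  have hm : Measurable fun x => h (Complex.measurableEquivRealProd.symm x) :=
    hh.comp Complex.measurableEquivRealProd.symm.measurable
  rw [stdComplexGaussian, lintegral_map hh Complex.measurableEquivRealProd.symm.measurable,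
    lintegral_prod_symm _ hm.aemeasurable]
  rfl

theorem lintegral_stdComplexGaussian_shift_le {h : ℂ → ℝ≥0∞} (hh : Measurable h) {a : ℝ}
    (ha : 0 ≤ a) (t : ℝ) :
    ∫⁻ z, h (z + a) * {z : ℂ | z.re ≤ t}.indicator 1 z ∂stdComplexGaussian
      ≤ ENNReal.ofReal (Real.exp (2 * a * t + a ^ 2)) * ∫⁻ z, h z ∂stdComplexGaussian := by
  have hs : MeasurableSet {z : ℂ | z.re ≤ t} :=
    measurableSet_le Complex.measurable_re measurable_const
  have hmk : ∀ y : ℝ, Measurable fun x : ℝ => (⟨x, y⟩ : ℂ) := fun y =>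
    Complex.measurableEquivRealProd.symm.measurable.comp (measurable_id.prodMk measurable_const)
  have hm2 : Measurable fun y : ℝ => ∫⁻ x, h ⟨x, y⟩ ∂gaussianReal 0 (1 / 2) :=
    (hh.comp Complex.measurableEquivRealProd.symm.measurable).lintegral_prod_left'
  have hm : Measurable fun z => h (z + a) * {z : ℂ | z.re ≤ t}.indicator 1 z :=
    (hh.comp (measurable_id.add_const _)).mul (measurable_one.indicator hs)
  rw [lintegral_stdComplexGaussian hh, lintegral_stdComplexGaussian hm,
    ← lintegral_const_mul _ hm2]
  refine lintegral_mono fun y => ?_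
  refine le_trans (le_of_eq ?_) (lintegral_gaussianReal_shift_le (hh.comp (hmk y)) ha t)
  refine lintegral_congr fun x => ?_
  have : (⟨x, y⟩ : ℂ) + a = ⟨x + a, y⟩ := by apply Complex.ext <;> simp
  simp only [Function.comp_apply, this]
  congr 1

theorem gaussianReal_tail_le {t : ℝ} (ht : 0 ≤ t) :
    gaussianReal 0 (1 / 2) (Set.Ici t) ≤ ENNReal.ofReal (Real.exp (-t ^ 2)) := by
  -- Chernoff bound; for variance `1 / 2` the exponent `-s t + s ^ 2 / 4` is minimal at `s = 2 t`.
  have h := measure_ge_le_exp_mul_mgf (μ := gaussianReal 0 (1 / 2)) (X := id) t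
    (t := 2 * t) (by positivity) (by
      simpa using integrable_exp_mul_gaussianReal (μ := 0) (v := 1 / 2) (2 * t))
  rw [mgf_gaussianReal (p := gaussianReal 0 (1 / 2)) (X := id) Measure.map_id, ← Real.exp_add] at h
  rw [← ofReal_measureReal]
  refine ENNReal.ofReal_le_ofReal (h.trans (Real.exp_le_exp.2 (le_of_eq ?_)))
  push_cast; ring

theorem stdComplexGaussian_re_ge_le {t : ℝ} (ht : 0 ≤ t) :
    stdComplexGaussian {z | t ≤ z.re} ≤ ENNReal.ofReal (Real.exp (-t ^ 2)) := by
  have hs : MeasurableSet {z : ℂ | t ≤ z.re} :=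
    measurableSet_le measurable_const Complex.measurable_re
  rw [stdComplexGaussian, Measure.map_apply Complex.measurableEquivRealProd.symm.measurable hs]
  have : Complex.measurableEquivRealProd.symm ⁻¹' {z : ℂ | t ≤ z.re}
      = Set.Ici t ×ˢ Set.univ := by
    ext x; simp [Complex.measurableEquivRealProd]
  rw [this, Measure.prod_prod]
  simpa using gaussianReal_tail_le ht

theorem stdComplexGaussian_re_le_neg_le {t : ℝ} (ht : 0 ≤ t) :
    stdComplexGaussian {z | z.re ≤ -t} ≤ ENNReal.ofReal (Real.exp (-t ^ 2)) := by
  have hs : MeasurableSet {z : ℂ | z.re ≤ -t} :=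
    measurableSet_le Complex.measurable_re measurable_const
  rw [stdComplexGaussian, Measure.map_apply Complex.measurableEquivRealProd.symm.measurable hs]
  have : Complex.measurableEquivRealProd.symm ⁻¹' {z : ℂ | z.re ≤ -t}
      = {x : ℝ | x ≤ -t} ×ˢ Set.univ := by
    ext x; simp [Complex.measurableEquivRealProd]
  rw [this, Measure.prod_prod]
  have hneg : (gaussianReal 0 (1 / 2)).map (fun x => -x) = gaussianReal 0 (1 / 2) := by
    rw [gaussianReal_map_neg]; simp
  have h := gaussianReal_tail_le ht
  rw [← hneg, Measure.map_apply (by fun_prop) measurableSet_Ici] at h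
  have h2 : (fun x : ℝ => -x) ⁻¹' (Set.Ici t) = {x | x ≤ -t} := by
    ext x; simp
  simpa [h2] using h

/-! ### Shifting one noise coordinate -/

instance (L B : ℕ) : IsProbabilityMeasure (noiseLaw L B) := by
  unfold noiseLaw; infer_instance

instance (L B : ℕ) [NeZero B] : IsProbabilityMeasure (positionLaw L B) := by
  unfold positionLaw; infer_instance

instance (L B : ℕ) [NeZero B] : IsProbabilityMeasure (jointLaw L B) := by
  unfold jointLaw; infer_instance

theorem noiseLaw_eval {L B : ℕ} (i : Fin L × Fin B) {S : Set ℂ} (hS : MeasurableSet S) :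
    noiseLaw L B {z | z i ∈ S} = stdComplexGaussian S :=
  (measurePreserving_eval (fun _ : Fin L × Fin B => stdComplexGaussian) i).measure_preimage
    hS.nullMeasurableSet

/-- Shifting one coordinate of the noise changes expectations of `[0, 1]`-valued functions by at
most a bounded factor, up to the probability that this coordinate is large. -/
theorem lintegral_noiseLaw_shift_le {L B : ℕ} {f : (Fin L × Fin B → ℂ) → ℝ≥0∞}
    (hf : Measurable f) (hf1 : ∀ y, f y ≤ 1) (i : Fin L × Fin B) {a t : ℝ} (ha : 0 ≤ a)
    (ht : 0 ≤ t) :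
    ∫⁻ z, f (z + Pi.single i (a : ℂ)) ∂noiseLaw L B
      ≤ ENNReal.ofReal (Real.exp (-t ^ 2))
        + ENNReal.ofReal (Real.exp (2 * a * t + a ^ 2)) * ∫⁻ z, f z ∂noiseLaw L B := by
  classical
  have hge : MeasurableSet {z : ℂ | t ≤ z.re} :=
    measurableSet_le measurable_const Complex.measurable_re
  have hle : MeasurableSet {z : ℂ | z.re ≤ t} :=
    measurableSet_le Complex.measurable_re measurable_const
  have hS : MeasurableSet {z : Fin L × Fin B → ℂ | z i ∈ {z : ℂ | t ≤ z.re}} :=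
    measurable_pi_apply i hge
  have hm : Measurable fun z : Fin L × Fin B → ℂ =>
      f (z + Pi.single i (a : ℂ)) * {z : ℂ | z.re ≤ t}.indicator 1 (z i) :=
    (hf.comp (measurable_id.add_const _)).mul
      ((measurable_one.indicator hle).comp (measurable_pi_apply i))
  have hsplit : ∀ z : Fin L × Fin B → ℂ, f (z + Pi.single i (a : ℂ)) ≤
      {z : Fin L × Fin B → ℂ | z i ∈ {z : ℂ | t ≤ z.re}}.indicator 1 z
        + f (z + Pi.single i (a : ℂ)) * {z : ℂ | z.re ≤ t}.indicator 1 (z i) := by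
    intro z
    rcases le_total t (z i).re with h | h
    · rw [Set.indicator_of_mem (by simpa using h)]
      exact (hf1 _).trans le_self_add
    · rw [Set.indicator_of_mem (s := {z : ℂ | z.re ≤ t}) (by simpa using h), Pi.one_apply, mul_one]
      exact le_add_self
  refine (lintegral_mono hsplit).trans ?_
  rw [lintegral_add_left (measurable_one.indicator hS), lintegral_indicator_one hS,
    noiseLaw_eval i hge]
  refine add_le_add (stdComplexGaussian_re_ge_le ht) ?_
  have hm2 : Measurable fun x : Fin L × Fin B → ℂ =>
      ∫⁻ s, f (Function.update x i s) ∂stdComplexGaussian := by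
    have := hf.lmarginal (s := {i}) fun _ : Fin L × Fin B => stdComplexGaussian
    rw [lmarginal_singleton] at this
    exact this
  -- Integrating coordinate `i` first, with the others frozen, reduces the claim to the scalar shift
  -- bound.
  rw [noiseLaw, lintegral_pi_update _ i hm, lintegral_pi_update _ i hf,
    ← lintegral_const_mul _ hm2]
  refine lintegral_mono fun x => ?_
  refine le_trans (le_of_eq ?_) (lintegral_stdComplexGaussian_shift_le
    (hf.comp (measurable_update x)) ha t)
  refine lintegral_congr fun s => ?_
  have : Function.update x i s + Pi.single i (a : ℂ) = Function.update x i (s + a) := by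
    funext k
    by_cases hk : k = i
    · subst hk; simp
    · simp [hk]
  simp [this]

/-! ### Removing a section from the observation -/

/-- The received vector `√ϱ s + z`. -/
def observation {L B : ℕ} (p : Fin L → ℝ) (ϱ : ℝ)
    (ω : (Fin L → Fin B) × (Fin L × Fin B → ℂ)) : Fin L × Fin B → ℂ :=
  fun i => ((Real.sqrt ϱ : ℝ) : ℂ) * signal B p ω.1 i + ω.2 i

theorem measurable_observation {L B : ℕ} (p : Fin L → ℝ) (ϱ : ℝ) :
    Measurable (observation (B := B) p ϱ) := by
  refine measurable_from_prod_countable_right fun pos => ?_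
  refine measurable_pi_lambda _ fun i => ?_
  simp only [observation]
  exact (measurable_pi_apply i).const_add _

/-- The received vector without the contribution of section `l`. -/
def observationWithout {L B : ℕ} (p : Fin L → ℝ) (ϱ : ℝ) (l : Fin L)
    (ω : (Fin L → Fin B) × (Fin L × Fin B → ℂ)) : Fin L × Fin B → ℂ :=
  fun i => (if i.1 = l then 0 else ((Real.sqrt ϱ : ℝ) : ℂ) * signal B p ω.1 i) + ω.2 i

theorem measurable_observationWithout {L B : ℕ} (p : Fin L → ℝ) (ϱ : ℝ) (l : Fin L) :
    Measurable (observationWithout (B := B) p ϱ l) := by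
  refine measurable_from_prod_countable_right fun pos => ?_
  refine measurable_pi_lambda _ fun i => ?_
  simp only [observationWithout]
  exact (measurable_pi_apply i).const_add _

/-- Only one entry of the section is nonzero, so its contribution can be read as a shift of a single
noise coordinate, to which the change of measure applies. -/
theorem observation_eq_without {L B : ℕ} (p : Fin L → ℝ) {ϱ : ℝ} (hϱ : 0 ≤ ϱ) (l : Fin L)
    (pos : Fin L → Fin B) (z : Fin L × Fin B → ℂ) :
    observation p ϱ (pos, z)
      = observationWithout p ϱ l (pos, z + Pi.single (l, pos l) ((√(ϱ * p l) : ℝ) : ℂ)) := by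
  funext ⟨k, j⟩
  by_cases hk : k = l
  · subst hk
    by_cases hj : pos k = j
    · subst hj
      simp [observation, observationWithout, signal, Real.sqrt_mul hϱ, add_comm]
    · have : ((k, j) : Fin L × Fin B) ≠ (k, pos k) := fun h => hj (by simpa using h.symm)
      simp [observation, observationWithout, signal, hj]
  · have : ((k, j) : Fin L × Fin B) ≠ (l, pos l) := fun h => hk (congrArg Prod.fst h)
    simp [observation, observationWithout, hk]

theorem observationWithout_update {L B : ℕ} (p : Fin L → ℝ) (ϱ : ℝ) (l : Fin L)
    (pos : Fin L → Fin B) (j : Fin B) (z : Fin L × Fin B → ℂ) :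
    observationWithout p ϱ l (Function.update pos l j, z) = observationWithout p ϱ l (pos, z) := by
  funext ⟨k, i⟩
  by_cases hk : k = l
  · simp [observationWithout, hk]
  · simp [observationWithout, signal, hk]

/-- Any randomised decision about the position in section `l` is correct only with small
probability, when the signal-to-noise ratio of the section is small. -/
theorem lintegral_decision_le {L B : ℕ} [NeZero B] (p : Fin L → ℝ) {ϱ : ℝ} (hϱ : 0 ≤ ϱ)
    (l : Fin L) {F : Fin B → (Fin L × Fin B → ℂ) → ℝ≥0∞} (hF : ∀ j, Measurable (F j))
    (hF1 : ∀ y, ∑ j, F j y ≤ 1) {t : ℝ} (ht : 0 ≤ t) :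
    ∫⁻ ω, F (ω.1 l) (observation p ϱ ω) ∂jointLaw L B
      ≤ ENNReal.ofReal (Real.exp (-t ^ 2))
        + ENNReal.ofReal (Real.exp (2 * √(ϱ * p l) * t + √(ϱ * p l) ^ 2)) / B := by
  have hFle : ∀ j y, F j y ≤ 1 := fun j y =>
    (Finset.single_le_sum (f := fun j => F j y) (fun _ _ => zero_le) (Finset.mem_univ j)).trans
      (hF1 y)
  have hm : Measurable fun ω : (Fin L → Fin B) × (Fin L × Fin B → ℂ) =>
      F (ω.1 l) (observation p ϱ ω) :=
    measurable_from_prod_countable_right fun pos =>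
      (hF (pos l)).comp ((measurable_observation p ϱ).comp measurable_prodMk_left)
  set c := ENNReal.ofReal (Real.exp (2 * √(ϱ * p l) * t + √(ϱ * p l) ^ 2))
  have hmw : ∀ j (pos : Fin L → Fin B), Measurable fun z : Fin L × Fin B → ℂ =>
      F j (observationWithout p ϱ l (pos, z)) := fun j pos =>
    (hF j).comp ((measurable_observationWithout p ϱ l).comp measurable_prodMk_left)
  rw [jointLaw, lintegral_prod _ hm.aemeasurable]
  have h1 : ∀ pos : Fin L → Fin B,
      ∫⁻ z, F (pos l) (observation p ϱ (pos, z)) ∂noiseLaw L B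
        ≤ ENNReal.ofReal (Real.exp (-t ^ 2)) +
          c * ∫⁻ z, F (pos l) (observationWithout p ϱ l (pos, z)) ∂noiseLaw L B := by
    intro pos
    simp_rw [observation_eq_without p hϱ l]
    exact lintegral_noiseLaw_shift_le (hmw (pos l) pos) (fun _ => hFle _ _) (l, pos l)
      (Real.sqrt_nonneg _) ht
  refine (lintegral_mono h1).trans ?_
  rw [lintegral_add_left measurable_const, lintegral_const, measure_univ, mul_one,
    lintegral_const_mul _ (measurable_of_countable _), ENNReal.div_eq_inv_mul, mul_comm _ c]
  gcongr
  -- Resample the position in section `l`: the reduced observation does not depend on it, so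
  -- averaging the decision weights over the `B` positions gives at most `1 / B`.
  rw [positionLaw, lintegral_pi_update _ l (measurable_of_countable _)]
  have h2 : ∀ pos : Fin L → Fin B,
      ∫⁻ j, ∫⁻ z, F (Function.update pos l j l)
          (observationWithout p ϱ l (Function.update pos l j, z)) ∂noiseLaw L B
        ∂uniformOn (Set.univ : Set (Fin B)) ≤ (B : ℝ≥0∞)⁻¹ := by
    intro pos
    rw [lintegral_uniformOn_univ, ENNReal.div_eq_inv_mul]
    simp_rw [observationWithout_update, Function.update_self]
    rw [← lintegral_finsetSum _ fun j _ => hmw j pos]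
    calc (B : ℝ≥0∞)⁻¹ * ∫⁻ z, ∑ j, F j (observationWithout p ϱ l (pos, z)) ∂noiseLaw L B
        ≤ (B : ℝ≥0∞)⁻¹ * ∫⁻ _, 1 ∂noiseLaw L B := by
          gcongr; exact hF1 _
      _ = (B : ℝ≥0∞)⁻¹ := by simp
  refine (lintegral_mono h2).trans ?_
  simp

/-! ### The MMSE as the least mean square error -/

/-- The conditional expectation is the best approximation in mean square. -/
theorem integral_norm_sub_condExp_sq_le {Ω ι : Type*} [Fintype ι] {m m0 : MeasurableSpace Ω}
    {μ : Measure Ω} [IsProbabilityMeasure μ] (hm : m ≤ m0)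
    {s g : Ω → EuclideanSpace ℂ ι} (hs : MemLp s 2 μ) (hg : MemLp g 2 μ)
    (hgm : AEStronglyMeasurable[m] g μ) :
    ∫ ω, ‖s ω - (μ[s | m]) ω‖ ^ 2 ∂μ ≤ ∫ ω, ‖s ω - g ω‖ ^ 2 ∂μ := by
  have hc : MemLp (μ[s | m]) 2 μ := hs.condExp (by norm_num)
  have hnorm : ∀ f : Ω → EuclideanSpace ℂ ι, ∀ hf : MemLp f 2 μ,
      ∫ ω, ‖f ω‖ ^ 2 ∂μ = ‖hf.toLp f‖ ^ 2 := by
    intro f hf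
    rw [← @inner_self_eq_norm_sq ℝ, L2.inner_def]
    simp only [RCLike.re_to_real]
    refine integral_congr_ae ?_
    filter_upwards [hf.coeFn_toLp] with ω h
    rw [h, real_inner_self_eq_norm_sq]
  have e1 := hnorm _ (hs.sub hc)
  have e2 := hnorm _ (hs.sub hg)
  simp only [Pi.sub_apply] at e1 e2
  rw [e1, e2, MemLp.toLp_sub hs hc, MemLp.toLp_sub hs hg]
  -- In `L²` the conditional expectation is the orthogonal projection onto the `m`-measurable
  -- classes, and `g` is a competitor in that subspace.
  have hproj : hc.toLp _ = (condExpL2 (EuclideanSpace ℂ ι) ℂ hm (hs.toLp s) : Ω →₂[μ] _) := by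
    refine Lp.ext ?_
    exact hc.coeFn_toLp.trans (hs.condExpL2_ae_eq_condExp hm).symm
  have hmem : hg.toLp g ∈ lpMeas (EuclideanSpace ℂ ι) ℂ m 2 μ := by
    rw [mem_lpMeas_iff_aestronglyMeasurable]
    exact hgm.congr hg.coeFn_toLp.symm
  rw [hproj]
  have : Fact (m ≤ m0) := ⟨hm⟩
  refine pow_le_pow_left₀ (norm_nonneg _) ?_ 2
  have h := (lpMeas (EuclideanSpace ℂ ι) ℂ m 2 μ).starProjection_minimal (hs.toLp s)
  have hle := ciInf_le (f := fun x : lpMeas (EuclideanSpace ℂ ι) ℂ m 2 μ => ‖hs.toLp s - x‖)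
    ⟨0, by rintro _ ⟨x, rfl⟩; exact norm_nonneg _⟩ ⟨hg.toLp g, hmem⟩
  exact h.trans_le hle

section Estimators

variable {L B : ℕ} (p : Fin L → ℝ) (ϱ : ℝ)

theorem measurable_signal :
    Measurable fun ω : (Fin L → Fin B) × (Fin L × Fin B → ℂ) => signal B p ω.1 :=
  (measurable_of_countable (signal B p)).comp measurable_fst

theorem memLp_signal [NeZero B] : MemLp (fun ω => signal B p ω.1) 2 (jointLaw L B) := by
  obtain ⟨C, hC⟩ := (Set.finite_range fun pos : Fin L → Fin B => ‖signal B p pos‖).bddAbove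
  exact MemLp.of_bound (measurable_signal p).aestronglyMeasurable C
    (ae_of_all _ fun ω => hC ⟨ω.1, rfl⟩)

theorem smul_signal_add_noise (ω : (Fin L → Fin B) × (Fin L × Fin B → ℂ)) :
    ((√ϱ : ℝ) : ℂ) • signal B p ω.1 + WithLp.toLp 2 ω.2 = WithLp.toLp 2 (observation p ϱ ω) := by
  ext i
  simp [observation]

/-- The mean square error of the estimate `g` of the signal from the received vector. -/
def meanSquareError (g : (Fin L × Fin B → ℂ) → EuclideanSpace ℂ (Fin L × Fin B)) : ℝ :=
  ∫ ω, ‖signal B p ω.1 - g (observation p ϱ ω)‖ ^ 2 ∂jointLaw L B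

/-- The conditional mean factors through the observation (Doob–Dynkin). Lower bounds that hold for
every estimator therefore pass to the MMSE. -/
theorem exists_mmse_eq_meanSquareError [NeZero B] :
    ∃ g : (Fin L × Fin B → ℂ) → EuclideanSpace ℂ (Fin L × Fin B), Measurable g ∧
      MemLp (fun ω => signal B p ω.1 - g (observation p ϱ ω)) 2 (jointLaw L B) ∧
      mmse B p ϱ = 1 / ((L : ℝ) * B) * meanSquareError p ϱ g := by
  set Y : (Fin L → Fin B) × (Fin L × Fin B → ℂ) → EuclideanSpace ℂ (Fin L × Fin B) :=
    fun ω => ((√ϱ : ℝ) : ℂ) • signal B p ω.1 + WithLp.toLp 2 ω.2 with hY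
  have hYo : Y = fun ω => WithLp.toLp 2 (observation p ϱ ω) :=
    funext fun ω => smul_signal_add_noise p ϱ ω
  obtain ⟨g, hg, hgY⟩ := (stronglyMeasurable_condExp (μ := jointLaw L B)
    (f := fun ω => signal B p ω.1)
    (m := MeasurableSpace.comap Y inferInstance)).exists_eq_measurable_comp
  refine ⟨fun y => g (WithLp.toLp 2 y), hg.measurable.comp (WithLp.measurable_toLp 2 _), ?_, ?_⟩
  · have h : (fun ω => g (WithLp.toLp 2 (observation p ϱ ω)))
        = (jointLaw L B)[fun ω => signal B p ω.1 | MeasurableSpace.comap Y inferInstance] := by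
      rw [hgY, hYo]; rfl
    have := (memLp_signal (B := B) p).sub ((memLp_signal (B := B) p).condExp
      (m := MeasurableSpace.comap Y inferInstance) (by norm_num))
    rw [← h] at this
    exact this
  · rw [mmse, totalMMSE, meanSquareError]
    congr 2
    funext ω
    rw [hgY]
    simp [hYo]

theorem mmse_le_meanSquareError [NeZero B]
    {g : (Fin L × Fin B → ℂ) → EuclideanSpace ℂ (Fin L × Fin B)} (hg : Measurable g)
    (hg2 : MemLp (fun ω => g (observation p ϱ ω)) 2 (jointLaw L B)) :
    mmse B p ϱ ≤ 1 / ((L : ℝ) * B) * meanSquareError p ϱ g := by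
  rw [mmse, totalMMSE, meanSquareError]
  refine mul_le_mul_of_nonneg_left ?_ (by positivity)
  have hYo : (fun ω : (Fin L → Fin B) × (Fin L × Fin B → ℂ) =>
      ((√ϱ : ℝ) : ℂ) • signal B p ω.1 + WithLp.toLp 2 ω.2)
      = fun ω => WithLp.toLp 2 (observation p ϱ ω) :=
    funext fun ω => smul_signal_add_noise p ϱ ω
  have hYm : Measurable fun ω : (Fin L → Fin B) × (Fin L × Fin B → ℂ) =>
      WithLp.toLp 2 (observation p ϱ ω) :=
    (WithLp.measurable_toLp 2 _).comp (measurable_observation p ϱ)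
  rw [hYo]
  refine integral_norm_sub_condExp_sq_le hYm.comap_le (memLp_signal p) hg2 ?_
  have : Measurable[MeasurableSpace.comap (fun ω => WithLp.toLp 2 (observation p ϱ ω))
      (inferInstance : MeasurableSpace (EuclideanSpace ℂ (Fin L × Fin B)))]
      fun ω => g (observation p ϱ ω) :=
    (hg.comp (WithLp.measurable_ofLp 2 _)).comp (comap_measurable
      (fun ω => WithLp.toLp 2 (observation p ϱ ω) :
        (Fin L → Fin B) × (Fin L × Fin B → ℂ) → EuclideanSpace ℂ (Fin L × Fin B)))
  exact this.stronglyMeasurable.aestronglyMeasurable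

end Estimators

/-! ### Sectionwise errors and the lower bound -/

/-- The squared error in section `l` of the estimate `v`, if the nonzero entry `√q` of the section
is at position `j`. -/
def sectionError {L B : ℕ} (q : ℝ) (l : Fin L) (j : Fin B)
    (v : EuclideanSpace ℂ (Fin L × Fin B)) : ℝ :=
  ∑ k, ‖(if j = k then ((√q : ℝ) : ℂ) else 0) - v (l, k)‖ ^ 2

theorem sectionError_nonneg {L B : ℕ} (q : ℝ) (l : Fin L) (j : Fin B)
    (v : EuclideanSpace ℂ (Fin L × Fin B)) : 0 ≤ sectionError q l j v :=
  Finset.sum_nonneg fun _ _ => sq_nonneg _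

theorem norm_signal_sub_sq {L B : ℕ} (p : Fin L → ℝ) (pos : Fin L → Fin B)
    (v : EuclideanSpace ℂ (Fin L × Fin B)) :
    ‖signal B p pos - v‖ ^ 2 = ∑ l, sectionError (p l) l (pos l) v := by
  rw [EuclideanSpace.norm_sq_eq, Fintype.sum_prod_type]
  rfl

theorem sectionError_eq {L B : ℕ} {q : ℝ} (hq : 0 ≤ q) (l : Fin L) (j : Fin B)
    (v : EuclideanSpace ℂ (Fin L × Fin B)) :
    sectionError q l j v = q - 2 * √q * (v (l, j)).re + ∑ k, ‖v (l, k)‖ ^ 2 := by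
  have h : ∀ k, ‖(if j = k then ((√q : ℝ) : ℂ) else 0) - v (l, k)‖ ^ 2
      = (if j = k then q - 2 * √q * (v (l, j)).re else 0) + ‖v (l, k)‖ ^ 2 := by
    intro k
    by_cases hk : j = k
    · subst hk
      simp only [if_true, ← Complex.normSq_eq_norm_sq, Complex.normSq_apply, Complex.sub_re,
        Complex.sub_im, Complex.ofReal_re, Complex.ofReal_im]
      nlinarith [Real.mul_self_sqrt hq]
    · simp [hk]
  rw [sectionError, Finset.sum_congr rfl fun k _ => h k, Finset.sum_add_distrib]
  simp

/-- No estimate is close to the section signals of many positions at the same time. -/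
theorem sum_max_one_sub_sectionError_le {L B : ℕ} {q : ℝ} (hq : 0 < q) (l : Fin L)
    (v : EuclideanSpace ℂ (Fin L × Fin B)) :
    ∑ j, max (1 - sectionError q l j v / q) 0 ≤ 1 := by
  classical
  set J := Finset.univ.filter fun j : Fin B => 0 < 1 - sectionError q l j v / q with hJ
  set G := ∑ k, ‖v (l, k)‖ ^ 2 with hG
  have h1 : ∑ j, max (1 - sectionError q l j v / q) 0
      = ∑ j ∈ J, (2 * √q * (v (l, j)).re - G) / q := by
    rw [hJ, Finset.sum_filter]
    refine Finset.sum_congr rfl fun j _ => ?_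
    split_ifs with h
    · rw [max_eq_left h.le, sectionError_eq hq.le]
      field_simp
      ring
    · exact max_eq_right (not_lt.1 h)
  rw [h1, ← Finset.sum_div, div_le_one hq, Finset.sum_sub_distrib, ← Finset.mul_sum,
    Finset.sum_const, nsmul_eq_mul]
  set R := ∑ j ∈ J, (v (l, j)).re
  -- Cauchy–Schwarz over `J` bounds the numerator `2 √q R - |J| G` by `2 √q R - R ^ 2 = q - (R - √q)
  -- ^ 2 ≤ q`.
  have h2 : R ^ 2 ≤ J.card * G := by
    refine sq_sum_le_card_mul_sum_sq.trans ?_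
    gcongr
    refine (Finset.sum_le_sum fun j _ => ?_).trans
      (Finset.sum_le_univ_sum_of_nonneg fun j => sq_nonneg ‖v (l, j)‖)
    exact sq_le_sq' (by linarith [(abs_le.1 (Complex.abs_re_le_norm (v (l, j)))).1])
      (Complex.re_le_norm _)
  nlinarith [sq_nonneg (R - √q), Real.sq_sqrt hq.le]

theorem measurable_sectionError {L B : ℕ} (q : ℝ) (l : Fin L) (j : Fin B) :
    Measurable (sectionError (B := B) q l j) := by
  unfold sectionError
  fun_prop

theorem measurable_sectionError_estimate {L B : ℕ} (p : Fin L → ℝ) (ϱ : ℝ) (l : Fin L)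
    {g : (Fin L × Fin B → ℂ) → EuclideanSpace ℂ (Fin L × Fin B)} (hg : Measurable g) :
    Measurable fun ω => sectionError (p l) l (ω.1 l) (g (observation p ϱ ω)) :=
  measurable_from_prod_countable_right fun pos => (measurable_sectionError _ _ (pos l)).comp
    (hg.comp ((measurable_observation p ϱ).comp measurable_prodMk_left))

theorem integrable_sectionError {L B : ℕ} (p : Fin L → ℝ) (ϱ : ℝ) (l : Fin L)
    {g : (Fin L × Fin B → ℂ) → EuclideanSpace ℂ (Fin L × Fin B)} (hg : Measurable g)
    (hg2 : MemLp (fun ω => signal B p ω.1 - g (observation p ϱ ω)) 2 (jointLaw L B)) :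
    Integrable (fun ω => sectionError (p l) l (ω.1 l) (g (observation p ϱ ω))) (jointLaw L B) := by
  refine hg2.integrable_norm_pow (by norm_num) |>.mono'
    (measurable_sectionError_estimate p ϱ l hg).aestronglyMeasurable (ae_of_all _ fun ω => ?_)
  rw [Real.norm_of_nonneg (sectionError_nonneg _ _ _ _)]
  have := norm_signal_sub_sq p ω.1 (g (observation p ϱ ω))
  refine le_trans ?_ this.ge
  exact Finset.single_le_sum (f := fun l => sectionError (p l) l (ω.1 l) (g (observation p ϱ ω)))
    (fun _ _ => sectionError_nonneg _ _ _ _) (Finset.mem_univ l)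

theorem meanSquareError_eq_sum {L B : ℕ} (p : Fin L → ℝ) (ϱ : ℝ)
    {g : (Fin L × Fin B → ℂ) → EuclideanSpace ℂ (Fin L × Fin B)} (hg : Measurable g)
    (hg2 : MemLp (fun ω => signal B p ω.1 - g (observation p ϱ ω)) 2 (jointLaw L B)) :
    meanSquareError p ϱ g
      = ∑ l, ∫ ω, sectionError (p l) l (ω.1 l) (g (observation p ϱ ω)) ∂jointLaw L B := by
  rw [meanSquareError, ← integral_finsetSum _ fun l _ => integrable_sectionError p ϱ l hg hg2]
  exact integral_congr_ae (ae_of_all _ fun ω => norm_signal_sub_sq p ω.1 _)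

/-- A section with a small signal-to-noise ratio cannot be estimated. -/
theorem le_integral_sectionError {L B : ℕ} [NeZero B] (p : Fin L → ℝ) {ϱ : ℝ} (hϱ : 0 ≤ ϱ)
    (l : Fin L) (hp : 0 < p l)
    {g : (Fin L × Fin B → ℂ) → EuclideanSpace ℂ (Fin L × Fin B)} (hg : Measurable g)
    (hg2 : MemLp (fun ω => signal B p ω.1 - g (observation p ϱ ω)) 2 (jointLaw L B))
    {t : ℝ} (ht : 0 ≤ t) :
    p l * (1 - (Real.exp (-t ^ 2) + Real.exp (2 * √(ϱ * p l) * t + √(ϱ * p l) ^ 2) / B))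
      ≤ ∫ ω, sectionError (p l) l (ω.1 l) (g (observation p ϱ ω)) ∂jointLaw L B := by
  set D := fun ω : (Fin L → Fin B) × (Fin L × Fin B → ℂ) =>
    sectionError (p l) l (ω.1 l) (g (observation p ϱ ω))
  have hD : Integrable D (jointLaw L B) := integrable_sectionError p ϱ l hg hg2
  have hB : (0 : ℝ) < B := by exact_mod_cast Nat.pos_of_ne_zero (NeZero.ne B)
  -- The positive parts of the relative gains serve as the weights of a randomised decision.
  have h1 := lintegral_decision_le (B := B) p hϱ l
    (F := fun j y => ENNReal.ofReal (1 - sectionError (p l) l j (g y) / p l))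
    (fun j => (measurable_const.sub
      (((measurable_sectionError _ _ j).comp hg).div_const _)).ennreal_ofReal)
    (fun y => by
      have h := sum_max_one_sub_sectionError_le hp l (g y)
      rw [← ENNReal.ofReal_one]
      refine le_trans (le_of_eq ?_) (ENNReal.ofReal_le_ofReal h)
      rw [ENNReal.ofReal_sum_of_nonneg fun _ _ => le_max_right _ _]
      refine Finset.sum_congr rfl fun j _ => ?_
      rw [ENNReal.ofReal_max, ENNReal.ofReal_zero, max_eq_left zero_le]) ht
  have h2 : ∫ ω, (1 - D ω / p l) ∂jointLaw L B
      ≤ (∫⁻ ω, ENNReal.ofReal (1 - D ω / p l) ∂jointLaw L B).toReal := by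
    have hi : Integrable (fun ω => 1 - D ω / p l) (jointLaw L B) :=
      (integrable_const _).sub (hD.div_const _)
    rw [integral_eq_lintegral_pos_part_sub_lintegral_neg_part hi]
    exact sub_le_self _ ENNReal.toReal_nonneg
  have h3 : (∫⁻ ω, ENNReal.ofReal (1 - D ω / p l) ∂jointLaw L B).toReal
      ≤ Real.exp (-t ^ 2) + Real.exp (2 * √(ϱ * p l) * t + √(ϱ * p l) ^ 2) / B := by
    refine ENNReal.toReal_le_of_le_ofReal (by positivity) (h1.trans (le_of_eq ?_))
    rw [ENNReal.ofReal_add (by positivity) (by positivity), ENNReal.ofReal_div_of_pos hB,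
      ENNReal.ofReal_natCast]
  rw [integral_sub (integrable_const _) (hD.div_const _), integral_div] at h2
  simp only [integral_const, probReal_univ, smul_eq_mul, mul_one] at h2
  have h4 := h2.trans h3
  rw [sub_le_comm, le_div_iff₀ hp] at h4
  linarith

/-! ### Thresholding and the upper bound -/

/-- Thresholding of the entries of the sections in `A`; the other sections are estimated by `0`. -/
def thresholdEstimate {L B : ℕ} (p : Fin L → ℝ) (ϱ k : ℝ) (A : Set (Fin L))
    (y : Fin L × Fin B → ℂ) : EuclideanSpace ℂ (Fin L × Fin B) :=
  open Classical in
  WithLp.toLp 2 fun i =>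
    if i.1 ∈ A ∧ k * √(ϱ * p i.1) < (y i).re then ((√(p i.1) : ℝ) : ℂ) else 0

theorem measurable_thresholdEstimate {L B : ℕ} (p : Fin L → ℝ) (ϱ k : ℝ) (A : Set (Fin L)) :
    Measurable (thresholdEstimate (B := B) p ϱ k A) := by
  classical
  refine (WithLp.measurable_toLp 2 _).comp (measurable_pi_lambda _ fun i => ?_)
  refine Measurable.ite ?_ measurable_const measurable_const
  exact (MeasurableSet.const _).inter
    (measurableSet_lt measurable_const (Complex.measurable_re.comp (measurable_pi_apply i)))

theorem memLp_thresholdEstimate {L B : ℕ} [NeZero B] (p : Fin L → ℝ) (ϱ k : ℝ)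
    (A : Set (Fin L)) :
    MemLp (fun ω => thresholdEstimate p ϱ k A (observation p ϱ ω)) 2 (jointLaw L B) := by
  classical
  refine MemLp.of_bound ((measurable_thresholdEstimate p ϱ k A).comp
    (measurable_observation p ϱ)).aestronglyMeasurable
    (√(∑ i : Fin L × Fin B, √(p i.1) ^ 2)) (ae_of_all _ fun ω => ?_)
  rw [EuclideanSpace.norm_eq]
  refine Real.sqrt_le_sqrt (Finset.sum_le_sum fun i _ => ?_)
  simp only [thresholdEstimate]
  split_ifs
  · simp
  · simp

theorem integral_sectionError_threshold_of_notMem {L B : ℕ} [NeZero B] (p : Fin L → ℝ) (ϱ k : ℝ)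
    {A : Set (Fin L)} {l : Fin L} (hl : l ∉ A) (hp : 0 ≤ p l) :
    ∫ ω, sectionError (p l) l (ω.1 l) (thresholdEstimate p ϱ k A (observation p ϱ ω))
      ∂jointLaw L B = p l := by
  have h : ∀ ω : (Fin L → Fin B) × (Fin L × Fin B → ℂ),
      sectionError (p l) l (ω.1 l) (thresholdEstimate p ϱ k A (observation p ϱ ω)) = p l := by
    intro ω
    rw [sectionError_eq hp]
    simp [thresholdEstimate, hl]
  simp [h]

/-- A section with a large signal-to-noise ratio is estimated correctly by thresholding. -/
theorem integral_sectionError_threshold_le {L B : ℕ} [NeZero B] (p : Fin L → ℝ) {ϱ k : ℝ}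
    (hϱ : 0 ≤ ϱ) (hk0 : 0 ≤ k) (hk1 : k ≤ 1) {A : Set (Fin L)} {l : Fin L} (hl : l ∈ A)
    (hp : 0 ≤ p l) :
    ∫ ω, sectionError (p l) l (ω.1 l) (thresholdEstimate p ϱ k A (observation p ϱ ω))
        ∂jointLaw L B
      ≤ p l * (Real.exp (-((1 - k) * √(ϱ * p l)) ^ 2)
        + B * Real.exp (-(k * √(ϱ * p l)) ^ 2)) := by
  classical
  set a := √(ϱ * p l) with ha
  have ha0 : 0 ≤ a := Real.sqrt_nonneg _
  set S : Set ℂ := {z | z.re ≤ -((1 - k) * a)}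
  set S' : Set ℂ := {z | k * a ≤ z.re}
  have hS : MeasurableSet S := measurableSet_le Complex.measurable_re measurable_const
  have hS' : MeasurableSet S' := measurableSet_le measurable_const Complex.measurable_re
  -- `M` contains every miss and `F j` every false alarm at `j`. Each costs `p l`. Counting `F j`
  -- also at the true position only enlarges the bound.
  set M : Set ((Fin L → Fin B) × (Fin L × Fin B → ℂ)) := {ω | ω.2 (l, ω.1 l) ∈ S}
  set F : Fin B → Set ((Fin L → Fin B) × (Fin L × Fin B → ℂ)) := fun j => {ω | ω.2 (l, j) ∈ S'}
  have hMm : MeasurableSet M := by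
    have : Measurable fun ω : (Fin L → Fin B) × (Fin L × Fin B → ℂ) => ω.2 (l, ω.1 l) :=
      measurable_from_prod_countable_right fun pos => measurable_pi_apply (l, pos l)
    exact this hS
  have hFm : ∀ j, MeasurableSet (F j) := fun j =>
    ((measurable_pi_apply (l, j)).comp measurable_snd) hS'
  have hM : jointLaw L B M ≤ ENNReal.ofReal (Real.exp (-((1 - k) * a) ^ 2)) := by
    rw [jointLaw, Measure.prod_apply hMm]
    have : ∀ pos : Fin L → Fin B, noiseLaw L B (Prod.mk pos ⁻¹' M)
        ≤ ENNReal.ofReal (Real.exp (-((1 - k) * a) ^ 2)) := fun pos =>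
      (noiseLaw_eval (l, pos l) hS).trans_le
        (stdComplexGaussian_re_le_neg_le (mul_nonneg (by linarith) ha0))
    exact (lintegral_mono this).trans (by simp)
  have hF : ∀ j, jointLaw L B (F j) ≤ ENNReal.ofReal (Real.exp (-(k * a) ^ 2)) := by
    intro j
    have : F j = Set.univ ×ˢ {z : Fin L × Fin B → ℂ | z (l, j) ∈ S'} := by
      ext ω; simp [F]
    rw [this, jointLaw, Measure.prod_prod, measure_univ, one_mul, noiseLaw_eval (l, j) hS']
    exact stdComplexGaussian_re_ge_le (mul_nonneg hk0 ha0)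
  have hpt : ∀ ω : (Fin L → Fin B) × (Fin L × Fin B → ℂ),
      ENNReal.ofReal (sectionError (p l) l (ω.1 l)
        (thresholdEstimate p ϱ k A (observation p ϱ ω)))
      ≤ ENNReal.ofReal (p l) * (M.indicator 1 ω + ∑ j, (F j).indicator 1 ω) := by
    intro ω
    rw [sectionError, ENNReal.ofReal_sum_of_nonneg fun _ _ => sq_nonneg _, mul_add,
      Finset.mul_sum]
    have hterm : ∀ j, ENNReal.ofReal (‖(if ω.1 l = j then ((√(p l) : ℝ) : ℂ) else 0)
          - thresholdEstimate p ϱ k A (observation p ϱ ω) (l, j)‖ ^ 2)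
        ≤ (if ω.1 l = j then ENNReal.ofReal (p l) * M.indicator 1 ω else 0)
          + ENNReal.ofReal (p l) * (F j).indicator 1 ω := by
      intro j
      have hobs : observation p ϱ ω (l, j) = (if ω.1 l = j then (a : ℂ) else 0) + ω.2 (l, j) := by
        simp only [observation, signal]
        split_ifs
        · rw [ha, Real.sqrt_mul hϱ]; push_cast; rfl
        · simp
      simp only [thresholdEstimate, hl, true_and, hobs]
      by_cases hj : ω.1 l = j
      · simp only [hj, if_true]
        by_cases hth : k * √(ϱ * p l) < ((a : ℂ) + ω.2 (l, j)).re
        · rw [if_pos hth]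
          simp
        · have hω : ω ∈ M := by
            simp only [Complex.add_re, Complex.ofReal_re, ← ha] at hth
            simp only [M, S, Set.mem_ofPred_eq, hj]
            linarith
          rw [if_neg hth, sub_zero, Complex.norm_of_nonneg (Real.sqrt_nonneg _),
            Real.sq_sqrt hp]
          simp [hω]
      · simp only [hj, if_false, zero_add]
        by_cases hth : k * √(ϱ * p l) < (ω.2 (l, j)).re
        · have hω : ω ∈ F j := by
            simp only [F, S', Set.mem_ofPred_eq]
            exact hth.le
          simp [hth, hω, Real.sq_sqrt hp]
        · simp [hth]
    refine (Finset.sum_le_sum fun j _ => hterm j).trans (le_of_eq ?_)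
    rw [Finset.sum_add_distrib]
    simp
  have hmeas := measurable_sectionError_estimate p ϱ l (measurable_thresholdEstimate (B := B) p ϱ k A)
  rw [integral_eq_lintegral_of_nonneg_ae (ae_of_all _ fun ω => sectionError_nonneg _ _ _ _)
    hmeas.aestronglyMeasurable]
  refine ENNReal.toReal_le_of_le_ofReal (by positivity) ((lintegral_mono hpt).trans ?_)
  rw [lintegral_const_mul _ (by
      exact (measurable_one.indicator hMm).add (Finset.measurable_sum _ fun j _ =>
        measurable_one.indicator (hFm j))),
    lintegral_add_left (measurable_one.indicator hMm), lintegral_indicator_one hMm,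
    lintegral_finsetSum _ fun j _ => measurable_one.indicator (hFm j),
    ENNReal.ofReal_mul hp, ENNReal.ofReal_add (by positivity) (by positivity),
    ENNReal.ofReal_mul (by positivity), ENNReal.ofReal_natCast]
  gcongr
  simp_rw [fun j => lintegral_indicator_one (μ := jointLaw L B) (hFm j)]
  refine (Finset.sum_le_sum fun j _ => hF j).trans (le_of_eq ?_)
  simp

/-! ### Power shares before the transition -/

open scoped Classical in
/-- The share of the total power in the sections that satisfy `S`. -/
def powerShare {L : ℕ} (B : ℕ) (p : Fin L → ℝ) (S : Fin L → Prop) : ℝ :=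
  ∑ l, if S l then p l / ((L : ℝ) * B) else 0

section

variable {L B : ℕ} {p : Fin L → ℝ}

theorem powerShare_le_one (hp : ∀ l, 0 ≤ p l) (h1 : ∑ l, p l / ((L : ℝ) * B) = 1)
    (S : Fin L → Prop) : powerShare B p S ≤ 1 := by
  rw [← h1]
  refine Finset.sum_le_sum fun l _ => ?_
  have := hp l
  split_ifs
  · rfl
  · positivity

theorem powerShare_nonneg (hp : ∀ l, 0 ≤ p l) (S : Fin L → Prop) : 0 ≤ powerShare B p S := by
  refine Finset.sum_nonneg fun l _ => ?_
  have := hp l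
  split_ifs <;> positivity

theorem powerShare_le_add (hp : ∀ l, 0 ≤ p l) {S U V : Fin L → Prop}
    (h : ∀ l, S l → U l ∨ V l) : powerShare B p S ≤ powerShare B p U + powerShare B p V := by
  rw [powerShare, powerShare, powerShare, ← Finset.sum_add_distrib]
  refine Finset.sum_le_sum fun l _ => ?_
  have h1 : 0 ≤ p l / ((L : ℝ) * B) := div_nonneg (hp l) (by positivity)
  have := h l
  by_cases hS : S l <;> by_cases hU : U l <;> by_cases hV : V l <;> simp_all

theorem transitionShare_eq_powerShare (δ ϱ : ℝ) :
    transitionShare B p δ ϱ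
      = powerShare B p fun l => |ϱ * p l - Real.log B| ≤ δ * Real.log B := rfl

/-- The sectionwise lower bounds are added, with `0` for sections above the level `s`. Charging the
relative loss `κ` to all sections costs exactly `κ`, as the total share is one. -/
theorem powerShare_sub_le_mmse [NeZero B] (hp : ∀ l, 0 < p l)
    (h1 : ∑ l, p l / ((L : ℝ) * B) = 1) {ϱ s t : ℝ} (hϱ : 0 ≤ ϱ) (ht : 0 ≤ t) :
    powerShare B p (fun l => ϱ * p l ≤ s) -
        (Real.exp (-t ^ 2) + Real.exp (2 * √s * t + s) / B) ≤ mmse B p ϱ := by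
  set κ := Real.exp (-t ^ 2) + Real.exp (2 * √s * t + s) / B with hκ
  have hκ0 : 0 ≤ κ := by positivity
  obtain ⟨g, hg, hg2, h⟩ := exists_mmse_eq_meanSquareError (B := B) p ϱ
  rw [h, meanSquareError_eq_sum p ϱ hg hg2, Finset.mul_sum]
  have hterm : ∀ l, (if ϱ * p l ≤ s then p l / ((L : ℝ) * B) else 0)
      - κ * (p l / ((L : ℝ) * B)) ≤ 1 / ((L : ℝ) * B) *
      ∫ ω, sectionError (p l) l (ω.1 l) (g (observation p ϱ ω)) ∂jointLaw L B := by
    intro l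
    have hpl := hp l
    split_ifs with hs
    · have h2 := le_integral_sectionError p hϱ l hpl hg hg2 ht
      have hsq : √(ϱ * p l) ^ 2 ≤ s := by rw [Real.sq_sqrt (by positivity)]; exact hs
      have h3 : p l * (1 - κ) ≤ p l * (1 - (Real.exp (-t ^ 2)
          + Real.exp (2 * √(ϱ * p l) * t + √(ϱ * p l) ^ 2) / B)) := by
        rw [hκ]; gcongr
      calc _ = 1 / ((L : ℝ) * B) * (p l * (1 - κ)) := by ring
        _ ≤ _ := by gcongr; exact h3.trans h2
    · refine le_trans (b := 0) ?_ ?_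
      · have : 0 ≤ κ * (p l / ((L : ℝ) * B)) := by positivity
        linarith
      · exact mul_nonneg (by positivity) (integral_nonneg fun _ => sectionError_nonneg _ _ _ _)
  refine le_trans (le_of_eq ?_) (Finset.sum_le_sum fun l _ => hterm l)
  rw [Finset.sum_sub_distrib, ← Finset.mul_sum, h1, mul_one, powerShare]

theorem mmse_le_powerShare_add [NeZero B] (hp : ∀ l, 0 < p l)
    (h1 : ∑ l, p l / ((L : ℝ) * B) = 1) {ϱ s k : ℝ} (hϱ : 0 ≤ ϱ) (hk0 : 0 ≤ k) (hk1 : k ≤ 1) :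
    mmse B p ϱ ≤ powerShare B p (fun l => ϱ * p l < s) +
        (Real.exp (-((1 - k) ^ 2 * s)) + B * Real.exp (-(k ^ 2 * s))) := by
  set κ := Real.exp (-((1 - k) ^ 2 * s)) + B * Real.exp (-(k ^ 2 * s)) with hκ
  have hκ0 : 0 ≤ κ := by positivity
  set A : Set (Fin L) := {l | s ≤ ϱ * p l}
  refine (mmse_le_meanSquareError p ϱ (measurable_thresholdEstimate (B := B) p ϱ k A)
    (memLp_thresholdEstimate p ϱ k A)).trans ?_
  rw [meanSquareError_eq_sum p ϱ (measurable_thresholdEstimate (B := B) p ϱ k A)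
    ((memLp_signal p).sub (memLp_thresholdEstimate p ϱ k A)), Finset.mul_sum]
  have hterm : ∀ l, 1 / ((L : ℝ) * B) * ∫ ω, sectionError (p l) l (ω.1 l)
        (thresholdEstimate p ϱ k A (observation p ϱ ω)) ∂jointLaw L B
      ≤ (if ϱ * p l < s then p l / ((L : ℝ) * B) else 0) + κ * (p l / ((L : ℝ) * B)) := by
    intro l
    have hpl := hp l
    split_ifs with hs
    · rw [integral_sectionError_threshold_of_notMem p ϱ k (by simpa [A] using hs) hpl.le]
      have : 0 ≤ κ * (p l / ((L : ℝ) * B)) := by positivity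
      calc _ = p l / ((L : ℝ) * B) := by ring
        _ ≤ _ := by linarith
    · have h2 := integral_sectionError_threshold_le (B := B) p hϱ hk0 hk1
        (A := A) (by simpa [A] using hs) hpl.le
      have hs' : s ≤ √(ϱ * p l) ^ 2 := by rw [Real.sq_sqrt (by positivity)]; exact not_lt.1 hs
      have h3 : p l * (Real.exp (-((1 - k) * √(ϱ * p l)) ^ 2)
          + B * Real.exp (-(k * √(ϱ * p l)) ^ 2)) ≤ p l * κ := by
        rw [hκ, mul_pow, mul_pow]; gcongr
      calc _ ≤ 1 / ((L : ℝ) * B) * (p l * κ) := by gcongr; exact h2.trans h3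
        _ = _ := by ring
  refine (Finset.sum_le_sum fun l _ => hterm l).trans (le_of_eq ?_)
  rw [Finset.sum_add_distrib, ← Finset.mul_sum, h1, mul_one, powerShare]

/-- The MMSE is the power share of the sections before their transition, up to the sections in
transition and an explicit error. -/
theorem abs_mmse_sub_powerShare_le [NeZero B] (hp : ∀ l, 0 < p l)
    (h1 : ∑ l, p l / ((L : ℝ) * B) = 1) {ϱ δ : ℝ} (hϱ : 0 ≤ ϱ) (hδ : 0 < δ) (hδ1 : δ ≤ 1 / 2) :
    |mmse B p ϱ - powerShare B p fun l => ϱ * p l < Real.log B|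
      ≤ 2 * Real.exp (-(δ ^ 2 / 16 * Real.log B)) + transitionShare B p δ ϱ := by
  have hB : (0 : ℝ) < B := by exact_mod_cast Nat.pos_of_ne_zero (NeZero.ne B)
  set T := Real.log B with hT
  have hT0 : 0 ≤ T := Real.log_natCast_nonneg B
  have hBT : (B : ℝ) = Real.exp T := (Real.exp_log hB).symm
  have hp0 : ∀ l, 0 ≤ p l := fun l => (hp l).le
  -- With this `t` the exponent `2 √s t + s - T` is at most `δ T / 2 - δ T = -δ T / 2`, while `t ^ 2
  -- = δ ^ 2 T / 16`.
  have hlow := powerShare_sub_le_mmse hp h1 (s := (1 - δ) * T) (t := δ / 4 * √T) hϱ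
    (by positivity)
  -- The threshold leaves room on both sides: `(1 - k) ^ 2 = δ ^ 2 / 16` controls misses, and `k ^ 2
  -- (1 + δ) ≥ 1 + δ / 4` for `δ ≤ 1 / 2` beats the `B` possible false alarms.
  have hup := mmse_le_powerShare_add hp h1 (s := (1 + δ) * T) (k := 1 - δ / 4) hϱ
    (by linarith) (by linarith)
  have hs1 := powerShare_le_add (B := B) hp0 (S := fun l => ϱ * p l < T)
    (U := fun l => ϱ * p l ≤ (1 - δ) * T) (V := fun l => |ϱ * p l - T| ≤ δ * T) fun l h => by
      by_cases h' : ϱ * p l ≤ (1 - δ) * T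
      · exact Or.inl h'
      · refine Or.inr (abs_le.2 ⟨by linarith, ?_⟩)
        have : 0 ≤ δ * T := by positivity
        linarith
  have hs2 := powerShare_le_add (B := B) hp0 (S := fun l => ϱ * p l < (1 + δ) * T)
    (U := fun l => ϱ * p l < T) (V := fun l => |ϱ * p l - T| ≤ δ * T) fun l h => by
      by_cases h' : ϱ * p l < T
      · exact Or.inl h'
      · refine Or.inr (abs_le.2 ⟨?_, by linarith⟩)
        have : 0 ≤ δ * T := by positivity
        linarith
  rw [← transitionShare_eq_powerShare] at hs1 hs2
  have hδ2 : δ ^ 2 / 16 ≤ δ / 4 := by nlinarith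
  have e1 : Real.exp (-(δ / 4 * √T) ^ 2) = Real.exp (-(δ ^ 2 / 16 * T)) := by
    congr 1
    rw [mul_pow, Real.sq_sqrt hT0]
    ring
  have e2 : Real.exp (2 * √((1 - δ) * T) * (δ / 4 * √T) + (1 - δ) * T) / B
      ≤ Real.exp (-(δ ^ 2 / 16 * T)) := by
    rw [hBT, ← Real.exp_sub, Real.exp_le_exp]
    have hsq : √((1 - δ) * T) ≤ √T := Real.sqrt_le_sqrt (by nlinarith)
    have h2 : √((1 - δ) * T) * √T ≤ T :=
      (mul_le_mul_of_nonneg_right hsq (Real.sqrt_nonneg _)).trans_eq (Real.mul_self_sqrt hT0)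
    nlinarith [mul_le_mul_of_nonneg_left h2 hδ.le, mul_le_mul_of_nonneg_right hδ2 hT0]
  have e3 : Real.exp (-((1 - (1 - δ / 4)) ^ 2 * ((1 + δ) * T)))
      ≤ Real.exp (-(δ ^ 2 / 16 * T)) := by
    rw [Real.exp_le_exp]
    have : 0 ≤ δ ^ 3 * T := by positivity
    nlinarith
  have e4 : B * Real.exp (-((1 - δ / 4) ^ 2 * ((1 + δ) * T)))
      ≤ Real.exp (-(δ ^ 2 / 16 * T)) := by
    rw [hBT, ← Real.exp_add, Real.exp_le_exp]
    have h2 : 1 + δ / 4 ≤ (1 - δ / 4) ^ 2 * (1 + δ) := by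
      nlinarith [mul_nonneg hδ.le (sub_nonneg.2 hδ1), pow_pos hδ 3]
    nlinarith [mul_le_mul_of_nonneg_right h2 hT0, mul_le_mul_of_nonneg_right hδ2 hT0]
  rw [abs_le]
  constructor <;> linarith

/-- As the powers decrease, the sections before their transition form a final segment; the interval
containing `ϱ` identifies its first element. -/
theorem transition_mem_iff (hp : ∀ l, 0 < p l) (hanti : Antitone p) {ϱ : ℝ} (hϱ : 0 ≤ ϱ)
    (l : Fin L) :
    (transitionPoint B p l.castSucc ≤ ϱ ∧ ϱ < transitionPoint B p l.succ) ↔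
      ∀ k, l ≤ k ↔ ϱ * p k < Real.log B := by
  have hsucc : ∀ k : Fin L, ϱ < transitionPoint B p k.succ ↔ ϱ * p k < Real.log B := fun k => by
    rw [transitionPoint, Fin.cons_succ, lt_div_iff₀ (hp k)]
  rw [hsucc]
  obtain _ | L := L
  · exact l.elim0
  refine Fin.cases ?_ (fun l => ?_) l
  · refine ⟨fun h k => ⟨fun _ => ?_, fun _ => Fin.zero_le k⟩, fun h => ⟨?_, (h 0).1 le_rfl⟩⟩
    · exact (mul_le_mul_of_nonneg_left (hanti (Fin.zero_le k)) hϱ).trans_lt h.2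
    · simpa [transitionPoint] using hϱ
  · have hcast := hsucc l.castSucc
    -- The left endpoint for section `l.succ` is the transition point of the preceding section
    -- `l.castSucc`.
    rw [← not_iff_not, not_lt, not_lt, Fin.succ_castSucc] at hcast
    rw [hcast]
    refine ⟨fun h k => ⟨fun hk => ?_, fun hk => ?_⟩, fun h => ⟨?_, (h _).1 le_rfl⟩⟩
    · exact (mul_le_mul_of_nonneg_left (hanti hk) hϱ).trans_lt h.2
    · by_contra hlt
      have hk' : k ≤ l.castSucc := Fin.le_castSucc_iff.2 (not_le.1 hlt)
      exact absurd (h.1.trans (mul_le_mul_of_nonneg_left (hanti hk') hϱ)) (not_le.2 hk)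
    · exact not_lt.1 fun hlt => absurd ((h _).2 hlt) (not_le.2 Fin.castSucc_lt_succ)

/-- The piecewise function in terms of the power share of the sections before their transition. -/
theorem piecewiseMMSE_eq (hp : ∀ l, 0 < p l) (hanti : Antitone p) {ϱ : ℝ} (hϱ : 0 ≤ ϱ) :
    piecewiseMMSE B p ϱ = powerShare B p (fun l => ϱ * p l < Real.log B) *
      (1 + ϱ * powerShare B p fun l => ϱ * p l < Real.log B)⁻¹ := by
  classical
  simp_rw [piecewiseMMSE, transition_mem_iff hp hanti hϱ]
  by_cases hne : ∃ l, ϱ * p l < Real.log B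
  -- The first section `m` before its transition gives the only nonzero summand, and its residual
  -- power is the whole share.
  · obtain ⟨m, hm, hmin⟩ := WellFounded.has_min (r := ((· < ·) : Fin L → Fin L → Prop))
      wellFounded_lt {l | ϱ * p l < Real.log B} hne
    have hIci : ∀ k, m ≤ k ↔ ϱ * p k < Real.log B := fun k =>
      ⟨fun hk => (mul_le_mul_of_nonneg_left (hanti hk) hϱ).trans_lt hm,
        fun hk => not_lt.1 (hmin k hk)⟩
    have hres : residualPower B p m = powerShare B p fun l => ϱ * p l < Real.log B := by
      rw [residualPower, powerShare, ← Finset.sum_filter]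
      refine Finset.sum_congr ?_ fun _ _ => rfl
      ext k
      simp [hIci k]
    rw [Finset.sum_eq_single m]
    · rw [if_pos hIci, hres, mul_one, gaussMMSE]
    · intro l _ hl
      rw [if_neg, mul_zero]
      intro h
      exact hl (le_antisymm ((h m).2 hm) ((hIci l).2 ((h l).1 le_rfl)))
    · simp
  · have hQ : (powerShare B p fun l => ϱ * p l < Real.log B) = 0 :=
      Finset.sum_eq_zero fun l _ => if_neg fun h => hne ⟨l, h⟩
    rw [hQ, zero_mul]
    refine Finset.sum_eq_zero fun l _ => ?_
    rw [if_neg, mul_zero]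
    intro h
    exact hne ⟨l, (h l).1 le_rfl⟩

/-- The difference between `Q` and `Q / (1 + ϱ Q)` is at most `ϱ Q`. If any section is before its
transition, then `ϱ c B ≤ log B`; otherwise `Q = 0`. -/
theorem abs_piecewiseMMSE_sub_powerShare_le [NeZero B] (hanti : Antitone p) {c : ℝ} (hc : 0 < c)
    (hpc : ∀ l, c * B ≤ p l) (h1 : ∑ l, p l / ((L : ℝ) * B) = 1) {ϱ : ℝ} (hϱ : 0 ≤ ϱ) :
    |piecewiseMMSE B p ϱ - powerShare B p fun l => ϱ * p l < Real.log B|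
      ≤ Real.log B / (c * B) := by
  have hB : (0 : ℝ) < B := by exact_mod_cast Nat.pos_of_ne_zero (NeZero.ne B)
  have hp : ∀ l, 0 < p l := fun l => (by positivity : 0 < c * B).trans_le (hpc l)
  have hT0 : 0 ≤ Real.log B := Real.log_natCast_nonneg B
  rw [piecewiseMMSE_eq hp hanti hϱ]
  set Q := powerShare B p fun l => ϱ * p l < Real.log B with hQ
  have hQ0 : 0 ≤ Q := powerShare_nonneg (fun l => (hp l).le) _
  have hQ1 : Q ≤ 1 := powerShare_le_one (fun l => (hp l).le) h1 _
  have hϱQ : ϱ * Q ≤ Real.log B / (c * B) := by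
    by_cases hne : ∃ l, ϱ * p l < Real.log B
    · obtain ⟨l, hl⟩ := hne
      refine (mul_le_of_le_one_right hϱ hQ1).trans ?_
      rw [le_div_iff₀ (by positivity)]
      exact (mul_le_mul_of_nonneg_left (hpc l) hϱ).trans hl.le
    · have : Q = 0 := Finset.sum_eq_zero fun l _ => if_neg fun h => hne ⟨l, h⟩
      rw [this, mul_zero]
      positivity
  refine le_trans ?_ hϱQ
  have h0 : 0 ≤ ϱ * Q := by positivity
  have heq : Q * (1 + ϱ * Q)⁻¹ - Q = -(ϱ * Q * (Q * (1 + ϱ * Q)⁻¹)) := by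
    field_simp
    ring
  have h2 : Q * (1 + ϱ * Q)⁻¹ ≤ 1 := by
    rw [← div_eq_mul_inv, div_le_one (by positivity)]
    linarith
  rw [heq, abs_neg, abs_of_nonneg (by positivity)]
  exact mul_le_of_le_one_right h0 h2

theorem transitionShare_mono (hp : ∀ l, 0 ≤ p l) (ϱ : ℝ) {δ δ' : ℝ} (h : δ ≤ δ') :
    transitionShare B p δ ϱ ≤ transitionShare B p δ' ϱ := by
  refine Finset.sum_le_sum fun l _ => ?_
  have h1 : 0 ≤ p l / ((L : ℝ) * B) := div_nonneg (hp l) (by positivity)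
  have h2 := mul_le_mul_of_nonneg_right h (Real.log_natCast_nonneg B)
  split_ifs with h3 h4
  · rfl
  · exact absurd (h3.trans h2) h4
  · exact h1
  · rfl

end

/-! ### Passage to the limit -/

theorem IsScaling.eventually_abs_mmse_sub_le {L B : ℕ → ℕ} {p : (n : ℕ) → Fin (L n) → ℝ}
    (h : IsScaling L B p) {ε δ : ℝ} (hε : 0 < ε) (hδ : 0 < δ) :
    ∀ᶠ n in atTop, ∀ ϱ : ℝ, 0 ≤ ϱ →
      |mmse (B n) (p n) ϱ - piecewiseMMSE (B n) (p n) ϱ|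
        ≤ ε + transitionShare (B n) (p n) δ ϱ := by
  obtain ⟨c, C, hc, hpc⟩ := h.power_order
  -- The finite-size bound needs accuracy at most `1 / 2`; monotonicity of the transition share
  -- restores `δ`. The remaining errors do not involve `ϱ`, whence the uniformity.
  set δ' := min δ (1 / 2)
  have hδ' : 0 < δ' := by positivity
  have hBR : Tendsto (fun n => (B n : ℝ)) atTop atTop :=
    tendsto_natCast_atTop_atTop.comp h.tendsto_dimension
  have hlim1 : Tendsto (fun n => 2 * Real.exp (-(δ' ^ 2 / 16 * Real.log (B n)))) atTop (𝓝 0) := by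
    have := (Real.tendsto_exp_neg_atTop_nhds_zero.comp
      ((Real.tendsto_log_atTop.comp hBR).const_mul_atTop
        (by positivity : 0 < δ' ^ 2 / 16))).const_mul 2
    simpa using this
  have hlim2 : Tendsto (fun n => Real.log (B n) / (c * B n)) atTop (𝓝 0) := by
    have h0 : Tendsto (fun x : ℝ => Real.log x / x) atTop (𝓝 0) :=
      Real.isLittleO_log_id_atTop.tendsto_div_nhds_zero
    have := (h0.comp hBR).const_mul c⁻¹
    rw [mul_zero] at this
    refine this.congr fun n => ?_
    simp only [Function.comp_apply]
    field_simp
  filter_upwards [h.tendsto_dimension.eventually_ge_atTop 1,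
    hlim1.eventually_le_const (half_pos hε), hlim2.eventually_le_const (half_pos hε)]
    with n hn h1 h2 ϱ hϱ
  have : NeZero (B n) := ⟨by omega⟩
  have hB : (0 : ℝ) < B n := by exact_mod_cast hn
  have hp : ∀ l, 0 < p n l := fun l => (by positivity : 0 < c * B n).trans_le (hpc n l).1
  have e1 := abs_mmse_sub_powerShare_le hp (h.power_constraint n) hϱ hδ' (min_le_right _ _)
  have e2 := abs_piecewiseMMSE_sub_powerShare_le (h.antitone_power n) hc
    (fun l => (hpc n l).1) (h.power_constraint n) hϱ
  have e3 := transitionShare_mono (B := B n) (fun l => (hp l).le) ϱ (min_le_left δ (1 / 2))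
  rw [abs_sub_comm] at e2
  have e4 := abs_sub_le (mmse (B n) (p n) ϱ)
    (powerShare (B n) (p n) fun l => ϱ * p n l < Real.log (B n))
    (piecewiseMMSE (B n) (p n) ϱ)
  linarith

end PositionModulated

end

theorem lemma5 (L B : ℕ → ℕ) (p : (n : ℕ) → Fin (L n) → ℝ)
    (h : PositionModulated.IsScaling L B p) :
    (∀ ε δ : ℝ, 0 < ε → 0 < δ → ∀ᶠ n in atTop, ∀ ϱ : ℝ, 0 ≤ ϱ →
      |PositionModulated.mmse (B n) (p n) ϱ - PositionModulated.piecewiseMMSE (B n) (p n) ϱ| ≤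
        ε + PositionModulated.transitionShare (B n) (p n) δ ϱ) ∧
    (∀ ϱ : ℕ → ℝ, (∀ n, 0 ≤ ϱ n) →
      (∀ η : ℝ, 0 < η → ∃ δ : ℝ, 0 < δ ∧
        ∀ᶠ n in atTop, PositionModulated.transitionShare (B n) (p n) δ (ϱ n) ≤ η) →
      Tendsto (fun n => PositionModulated.mmse (B n) (p n) (ϱ n) -
        PositionModulated.piecewiseMMSE (B n) (p n) (ϱ n)) atTop (𝓝 0)) := by
  refine ⟨fun ε δ hε hδ => h.eventually_abs_mmse_sub_le hε hδ, fun ϱ hϱ hη => ?_⟩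
  rw [Metric.tendsto_nhds]
  intro ε hε
  -- Thirds make the total `2 ε / 3`, strictly below `ε`.
  obtain ⟨δ, hδ, hshare⟩ := hη (ε / 3) (by positivity)
  filter_upwards [hshare, h.eventually_abs_mmse_sub_le (show 0 < ε / 3 by positivity) hδ]
    with n h1 h2
  rw [Real.dist_0_eq_abs]
  linarith [h2 (ϱ n) (hϱ n)]
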